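/- Let $\mathcal{C}^*_1$ be the category of unital complex $C^*$-algebras (the zero algebra included) with unital $*$-homomorphisms, and $\mathcal{C}^*_{c,1}$ its full subcategory of commutative algebras. Let $\mathbf{Ban}$ be the category of complex Banach spaces with linear maps of norm $\le 1$. Let $\mathbf{BanAlg}_1$ be the category of unital complex Banach algebras (with $\|xy\|\le\|x\|\|y\|$ and $\|1\|\le 1$) with contractive unital algebra homomorphisms, and $\mathbf{BanAlg}^*_1$ the category of unital complex Banach $*$-algebras (unital Banach algebras with an isometric, conjugate-linear, antimultiplicative involution) with contractive unital $*$-homomorphisms. Let $\mathbf{BanAlg}_{c,1}$ and $\mathbf{BanAlg}^*_{c,1}$ be their full subcategories of commutative algebras. A functor $G$ is *monadic* if it has a left adjoint $F$ such that the comparison functor from the domain of $G$ to the Eilenberg–Moore category of algebras over the monad $GF$ is an equivalence of categories. Then the following forgetful functors are all monadic: (a) $\mathcal{C}^*_1\to\mathbf{BanAlg}^*_1$, $\ \mathcal{C}^*_1\to\mathbf{BanAlg}_1$, and $\ \mathcal{C}^*_1\to\mathbf{Ban}$; (b) $\mathcal{C}^*_{c,1}\to\mathbf{BanAlg}^*_{c,1}$,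 $\ \mathcal{C}^*_{c,1}\to\mathbf{BanAlg}_{c,1}$, and $\ \mathcal{C}^*_{c,1}\to\mathbf{Ban}$. -/

import Mathlib

open CategoryTheory

universe u

/-! Banach spaces and contractions -/

/-- Complex Banach spaces. -/
structure BanCat : Type (u + 1) where
  carrier : Type u
  [normedAddCommGroup : NormedAddCommGroup carrier]
  [normedSpace : NormedSpace ℂ carrier]
  [completeSpace : CompleteSpace carrier]

namespace BanCat

instance : CoeSort BanCat.{u} (Type u) := ⟨BanCat.carrier⟩

attribute [instance] normedAddCommGroup normedSpace completeSpace

/-- Linear maps of norm at most `1`. -/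
@[ext]
structure Hom (V W : BanCat.{u}) : Type u where
  hom : V →ₗ[ℂ] W
  norm_le : ∀ x : V, ‖hom x‖ ≤ ‖x‖

instance : Category.{u} BanCat.{u} where
  Hom := Hom
  id _ := ⟨LinearMap.id, fun _ => le_rfl⟩
  comp f g := ⟨g.hom.comp f.hom, fun x => (g.norm_le (f.hom x)).trans (f.norm_le x)⟩

end BanCat

/-! Unital Banach algebras -/

/-- Unital complex Banach algebras. The norm is submultiplicative and `‖1‖ ≤ 1`; equivalently
`‖1‖ = 1` unless the algebra is the zero algebra. -/
structure BanAlgCat : Type (u + 1) where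
  carrier : Type u
  [normedRing : NormedRing carrier]
  [normedAlgebra : NormedAlgebra ℂ carrier]
  [completeSpace : CompleteSpace carrier]
  norm_one_le : ‖(1 : carrier)‖ ≤ 1

namespace BanAlgCat

instance : CoeSort BanAlgCat.{u} (Type u) := ⟨BanAlgCat.carrier⟩

attribute [instance] normedRing normedAlgebra completeSpace

/-- Contractive unital algebra homomorphisms. -/
@[ext]
structure Hom (A B : BanAlgCat.{u}) : Type u where
  hom : A →ₐ[ℂ] B
  norm_le : ∀ x : A, ‖hom x‖ ≤ ‖x‖

instance : Category.{u} BanAlgCat.{u} where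
  Hom := Hom
  id A := ⟨AlgHom.id ℂ A, fun _ => le_rfl⟩
  comp f g := ⟨g.hom.comp f.hom, fun x => (g.norm_le (f.hom x)).trans (f.norm_le x)⟩

/-- The forgetful functor from unital Banach algebras to Banach spaces. -/
noncomputable def toBan : BanAlgCat.{u} ⥤ BanCat.{u} where
  obj A := { carrier := A }
  map f := ⟨f.hom.toLinearMap, f.norm_le⟩

/-- Commutativity of a unital Banach algebra. -/
def IsComm : ObjectProperty BanAlgCat.{u} := fun A => ∀ x y : A, x * y = y * x

end BanAlgCat

/-- Unital commutative Banach algebras, a full subcategory of unital Banach algebras. -/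
abbrev CommBanAlgCat : Type (u + 1) := BanAlgCat.IsComm.{u}.FullSubcategory

/-! Unital Banach star-algebras -/

/-- Unital complex Banach star-algebras: unital Banach algebras with an isometric,
conjugate-linear, antimultiplicative involution. -/
structure BanStarAlgCat : Type (u + 1) where
  carrier : Type u
  [normedRing : NormedRing carrier]
  [normedAlgebra : NormedAlgebra ℂ carrier]
  [completeSpace : CompleteSpace carrier]
  [starRing : StarRing carrier]
  [starModule : StarModule ℂ carrier]
  [normedStarGroup : NormedStarGroup carrier]
  norm_one_le : ‖(1 : carrier)‖ ≤ 1

namespace BanStarAlgCat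

instance : CoeSort BanStarAlgCat.{u} (Type u) := ⟨BanStarAlgCat.carrier⟩

attribute [instance] normedRing normedAlgebra completeSpace starRing starModule normedStarGroup

/-- Contractive unital star-algebra homomorphisms. -/
@[ext]
structure Hom (A B : BanStarAlgCat.{u}) : Type u where
  hom : A →⋆ₐ[ℂ] B
  norm_le : ∀ x : A, ‖hom x‖ ≤ ‖x‖

instance : Category.{u} BanStarAlgCat.{u} where
  Hom := Hom
  id A := ⟨StarAlgHom.id ℂ A, fun _ => le_rfl⟩
  comp f g := ⟨g.hom.comp f.hom, fun x => (g.norm_le (f.hom x)).trans (f.norm_le x)⟩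

/-- The functor from unital Banach star-algebras to unital Banach algebras that forgets the
involution. -/
noncomputable def toBanAlg : BanStarAlgCat.{u} ⥤ BanAlgCat.{u} where
  obj A := { carrier := A, norm_one_le := A.norm_one_le }
  map f := ⟨f.hom.toAlgHom, f.norm_le⟩

/-- Commutativity of a unital Banach star-algebra. -/
def IsComm : ObjectProperty BanStarAlgCat.{u} := fun A => ∀ x y : A, x * y = y * x

end BanStarAlgCat

/-- Unital commutative Banach star-algebras, a full subcategory of unital Banach star-algebras. -/
abbrev CommBanStarAlgCat : Type (u + 1) := BanStarAlgCat.IsComm.{u}.FullSubcategory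

/-! Unital C*-algebras -/

/-- Unital (complex) C*-algebras, the zero algebra included. -/
structure CStarAlgCat : Type (u + 1) where
  carrier : Type u
  [cstarAlgebra : CStarAlgebra carrier]

namespace CStarAlgCat

instance : CoeSort CStarAlgCat.{u} (Type u) := ⟨CStarAlgCat.carrier⟩

attribute [instance] cstarAlgebra

/-- Unital star-algebra homomorphisms; these are automatically contractive. -/
@[ext]
structure Hom (A B : CStarAlgCat.{u}) : Type u where
  hom : A →⋆ₐ[ℂ] B

instance : Category.{u} CStarAlgCat.{u} where
  Hom := Hom
  id A := ⟨StarAlgHom.id ℂ A⟩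
  comp f g := ⟨g.hom.comp f.hom⟩

theorem norm_one_le (A : Type u) [CStarAlgebra A] : ‖(1 : A)‖ ≤ 1 := by
  rcases subsingleton_or_nontrivial A with h | h
  · rw [Subsingleton.elim (1 : A) 0, norm_zero]
    exact zero_le_one
  · exact CStarRing.norm_one.le

/-- The forgetful functor from unital C*-algebras to unital Banach star-algebras. -/
noncomputable def toBanStarAlg : CStarAlgCat.{u} ⥤ BanStarAlgCat.{u} where
  obj A := { carrier := A, norm_one_le := norm_one_le A }
  map f := ⟨f.hom, fun x => NonUnitalStarAlgHom.norm_apply_le f.hom x⟩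

/-- The forgetful functor from unital C*-algebras to unital Banach algebras. -/
noncomputable def toBanAlg : CStarAlgCat.{u} ⥤ BanAlgCat.{u} :=
  toBanStarAlg ⋙ BanStarAlgCat.toBanAlg

/-- The forgetful functor from unital C*-algebras to Banach spaces. -/
noncomputable def toBan : CStarAlgCat.{u} ⥤ BanCat.{u} :=
  toBanAlg ⋙ BanAlgCat.toBan

/-- Commutativity of a unital C*-algebra. -/
def IsComm : ObjectProperty CStarAlgCat.{u} := fun A => ∀ x y : A, x * y = y * x

end CStarAlgCat

/-- Unital commutative C*-algebras, a full subcategory of unital C*-algebras. -/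
abbrev CommCStarAlgCat : Type (u + 1) := CStarAlgCat.IsComm.{u}.FullSubcategory

namespace CommCStarAlgCat

/-- The forgetful functor from unital commutative C*-algebras to unital commutative Banach
star-algebras. -/
noncomputable def toCommBanStarAlg : CommCStarAlgCat.{u} ⥤ CommBanStarAlgCat.{u} :=
  BanStarAlgCat.IsComm.lift (CStarAlgCat.IsComm.ι ⋙ CStarAlgCat.toBanStarAlg)
    (fun A => A.property)

/-- The forgetful functor from unital commutative C*-algebras to unital commutative Banach
algebras. -/
noncomputable def toCommBanAlg : CommCStarAlgCat.{u} ⥤ CommBanAlgCat.{u} :=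
  BanAlgCat.IsComm.lift (CStarAlgCat.IsComm.ι ⋙ CStarAlgCat.toBanAlg)
    (fun A => A.property)

/-- The forgetful functor from unital commutative C*-algebras to Banach spaces. -/
noncomputable def toBan : CommCStarAlgCat.{u} ⥤ BanCat.{u} :=
  CStarAlgCat.IsComm.ι ⋙ CStarAlgCat.toBan

end CommCStarAlgCat

/-! The proof applies Beck's criterion: a right adjoint that reflects isomorphisms is monadic once
the pairs it sends to split pairs have coequalizers that it preserves.

Left adjoints are universal C*-algebras. Morphisms out of a Banach space or algebra `X` are
norm-bounded maps on its elements, and their defining conditions can be tested along any jointly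
norming family of star-homomorphisms. A set of test maps suffices to realize every norm of every
star-polynomial in the generators; the C*-subalgebra generated by `X` in the bounded product of
their targets is universal (`CStarAlgCat.exists_universal`). Commutativity can also be tested along
norming families, so the commutative case is the same.

For coequalizers, suppose `f, g : A ⟶ B` split over Banach spaces, with coequalizer map `h` and a
contraction `t` such that `g t = 1` and `f t` factors through `h`. Then `ker h = g (ker f)`: `t`
lifts `ker h` into `ker f`, and `h g = h f`. Hence `ker h` is a closed star-stable two-sided ideal,
and the C*-algebra `B / ker h` is the coequalizer both of C*-algebras and of Banach spaces
(`exists_coequalizer`).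

The functors to Banach algebras and Banach star-algebras inherit the coequalizer condition from the
composite to Banach spaces, since split coequalizers are absolute and the second factor reflects
isomorphisms. -/

/-! Quotients of C*-algebras by closed star-stable two-sided ideals -/

namespace CStarAlgebra

open Filter Topology

section Quotient

variable {A : Type u} [CStarAlgebra A] (I : Ideal A)

/-- A closed star-stable two-sided ideal, as a non-unital star-subalgebra. -/
def idealStarSubalgebra [I.IsTwoSided] (hs : ∀ x ∈ I, star x ∈ I) :
    NonUnitalStarSubalgebra ℂ A where
  carrier := I
  add_mem' := I.add_mem
  zero_mem' := I.zero_mem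
  mul_mem' _ hb := I.mul_mem_left _ hb
  smul_mem' c x hx := by
    rw [← one_mul x, ← smul_mul_assoc]
    exact I.mul_mem_left _ hx
  star_mem' := hs _

attribute [local instance] CStarAlgebra.spectralOrder CStarAlgebra.spectralOrderedRing

theorem norm_one_sub_le_one {u : A} (h0 : 0 ≤ u) (h1 : ‖u‖ ≤ 1) : ‖1 - u‖ ≤ 1 := by
  have h2 : u ≤ 1 := (CStarAlgebra.norm_le_one_iff_of_nonneg u h0).1 h1
  refine (CStarAlgebra.norm_le_one_iff_of_nonneg _ (sub_nonneg.2 h2)).2 ?_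
  simpa using h0

/-- A closed star-stable ideal contains approximate right units that are positive contractions. -/
theorem exists_right_approximateUnit_of_ideal [I.IsTwoSided] [hI : IsClosed (I : Set A)]
    (hs : ∀ x ∈ I, star x ∈ I) (i : A) (hi : i ∈ I) {ε : ℝ} (hε : 0 < ε) :
    ∃ e ∈ I, 0 ≤ e ∧ ‖e‖ ≤ 1 ∧ ‖i - i * e‖ < ε := by
  -- A closed star-stable ideal is a non-unital C*-algebra, so it has its own increasing approximate
  -- unit.
  let N := idealStarSubalgebra I hs
  have : IsClosed (N : Set A) := hI
  let _ : PartialOrder N := CStarAlgebra.spectralOrder N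
  have : StarOrderedRing N := CStarAlgebra.spectralOrderedRing N
  have hl := CStarAlgebra.increasingApproximateUnit N
  have := hl.neBot
  let j : N := ⟨i, hi⟩
  have ht : Tendsto (fun u : N => ‖j - j * u‖) (approximateUnit N) (𝓝 0) := by
    have := ((tendsto_const_nhds (x := j)).sub (hl.tendsto_mul_left j)).norm
    simpa using this
  obtain ⟨v, ⟨hv0, hv1⟩, hv2⟩ :=
    ((hl.eventually_nonneg.and hl.eventually_norm).and (ht.eventually (gt_mem_nhds hε))).exists
  refine ⟨v, v.2, ?_, hv1, hv2⟩
  -- Positivity for the order of `N` passes to `A` through the form `star b * b`.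
  obtain ⟨b, rfl⟩ := CStarAlgebra.nonneg_iff_eq_star_mul_self.1 hv0
  exact star_mul_self_nonneg (b : A)

/-- The C*-inequality for the quotient norm, before taking the infimum over `i`. With `e` an
approximate right unit for `i`, the representative `x * (1 - e)` of the class of `x` has norm
squared at most `‖star x * x * (1 - e)‖`, and `i * (1 - e)` is negligible. -/
theorem norm_mk_mul_self_le [I.IsTwoSided] [IsClosed (I : Set A)]
    (hs : ∀ x ∈ I, star x ∈ I) (x i : A) (hi : i ∈ I) :
    ‖(Submodule.Quotient.mk x : A ⧸ I)‖ * ‖(Submodule.Quotient.mk x : A ⧸ I)‖ ≤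
      ‖star x * x + i‖ := by
  refine le_of_forall_pos_le_add fun ε hε => ?_
  obtain ⟨e, heI, he0, he1, hie⟩ := exists_right_approximateUnit_of_ideal I hs i hi hε
  have hd := norm_one_sub_le_one he0 he1
  have hsa : star (1 - e) = 1 - e := by
    rw [star_sub, star_one, (IsSelfAdjoint.of_nonneg he0).star_eq]
  have hx : ‖(Submodule.Quotient.mk x : A ⧸ I)‖ ≤ ‖x * (1 - e)‖ := by
    have : (Submodule.Quotient.mk x : A ⧸ I) = Submodule.Quotient.mk (x * (1 - e)) := by
      rw [Submodule.Quotient.eq, mul_sub, mul_one, sub_sub_cancel]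
      exact I.mul_mem_left _ heI
    rw [this]
    exact Submodule.Quotient.norm_mk_le _ _
  calc _ ≤ ‖x * (1 - e)‖ * ‖x * (1 - e)‖ := by gcongr
    _ = ‖(1 - e) * (star x * x * (1 - e))‖ := by
      rw [← CStarRing.norm_star_mul_self, star_mul, hsa]; simp only [mul_assoc]
    _ ≤ 1 * ‖star x * x * (1 - e)‖ := (norm_mul_le _ _).trans (by gcongr)
    _ = ‖(star x * x + i) * (1 - e) - (i - i * e)‖ := by
      rw [one_mul]; congr 1; noncomm_ring
    _ ≤ ‖(star x * x + i) * (1 - e)‖ + ‖i - i * e‖ := norm_sub_le _ _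
    _ ≤ ‖star x * x + i‖ * 1 + ε := by
      gcongr
      exact (norm_mul_le _ _).trans (by gcongr)
    _ = _ := by rw [mul_one]

end Quotient

/-- The quotient of a C*-algebra by a closed star-stable two-sided ideal. -/
@[reducible]
noncomputable def quotient {A : Type u} [CStarAlgebra A] (I : Ideal A) [I.IsTwoSided]
    [IsClosed (I : Set A)] (hs : ∀ x ∈ I, star x ∈ I) : CStarAlgebra (A ⧸ I) where
  __ := Ideal.Quotient.ring I
  __ := Submodule.Quotient.normedAddCommGroup I
  __ := (inferInstance : Algebra ℂ (A ⧸ I))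
  complete := (Submodule.Quotient.completeSpace I).complete
  norm_mul_le x y := by
    refine le_of_forall_pos_lt_add fun ε hε => ?_
    have hc : Filter.Tendsto (fun δ : ℝ => (‖x‖ + δ) * (‖y‖ + δ)) (nhdsWithin 0 (Set.Ioi 0))
        (nhds (‖x‖ * ‖y‖)) := by
      have : Continuous fun δ : ℝ => (‖x‖ + δ) * (‖y‖ + δ) := by fun_prop
      simpa using (this.tendsto 0).mono_left nhdsWithin_le_nhds
    obtain ⟨δ, hδ, hδ0⟩ := ((hc.eventually (gt_mem_nhds (lt_add_of_pos_right _ hε))).and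
      self_mem_nhdsWithin).exists
    obtain ⟨a, rfl, ha⟩ := Submodule.Quotient.norm_mk_lt x hδ0
    obtain ⟨b, rfl, hb⟩ := Submodule.Quotient.norm_mk_lt y hδ0
    refine lt_of_le_of_lt ?_ hδ
    calc _ ≤ ‖a * b‖ := Submodule.Quotient.norm_mk_le I (a * b)
      _ ≤ ‖a‖ * ‖b‖ := norm_mul_le _ _
      _ ≤ _ := by gcongr
  norm_smul_le := norm_smul_le
  star := Quotient.map' star fun a b h => by
    rw [Submodule.quotientRel_def] at h ⊢
    rw [← star_sub]
    exact hs _ h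
  star_involutive x := by
    obtain ⟨x, rfl⟩ := Submodule.Quotient.mk_surjective _ x
    exact congrArg (Submodule.Quotient.mk (p := I)) (star_star x)
  star_mul x y := by
    obtain ⟨x, rfl⟩ := Submodule.Quotient.mk_surjective _ x
    obtain ⟨y, rfl⟩ := Submodule.Quotient.mk_surjective _ y
    exact congrArg (Submodule.Quotient.mk (p := I)) (star_mul x y)
  star_add x y := by
    obtain ⟨x, rfl⟩ := Submodule.Quotient.mk_surjective _ x
    obtain ⟨y, rfl⟩ := Submodule.Quotient.mk_surjective _ y
    exact congrArg (Submodule.Quotient.mk (p := I)) (star_add x y)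
  star_smul c x := by
    obtain ⟨x, rfl⟩ := Submodule.Quotient.mk_surjective _ x
    exact congrArg (Submodule.Quotient.mk (p := I)) (star_smul c x)
  norm_mul_self_le x := by
    obtain ⟨x, rfl⟩ := Submodule.Quotient.mk_surjective _ x
    -- The quotient norm is an infimum over representatives `m`, each of the form `star x * x + i`
    -- with `i ∈ I`.
    refine (QuotientAddGroup.le_norm_iff (S := I.toAddSubgroup)).2 fun m hm => ?_
    have h : m - star x * x ∈ I := (Submodule.Quotient.eq I).1 hm
    simpa using norm_mk_mul_self_le I hs x _ h

end CStarAlgebra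

/-! Universal C*-algebras -/

namespace CStarAlgebra

open scoped ENNReal

noncomputable section

/-- The bounded families in a family of nontrivial C*-algebras form a C*-algebra. -/
@[reducible]
def lpInfty {J : Type u} (A : J → Type u) [∀ j, CStarAlgebra (A j)] [∀ j, Nontrivial (A j)] :
    CStarAlgebra (lp A ∞) where

/-- The evaluation of bounded families at an index. -/
def lpEval {J : Type u} (A : J → Type u) [∀ j, CStarAlgebra (A j)] [∀ j, Nontrivial (A j)]
    (j : J) : lp A ∞ →⋆ₐ[ℂ] A j where
  toFun x := x j
  map_one' := rfl
  map_mul' _ _ := rfl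
  map_zero' := rfl
  map_add' _ _ := rfl
  commutes' _ := rfl
  map_star' _ := rfl

/-- The extension of a map into a star-algebra to noncommutative polynomials in the generators and
their formal adjoints. -/
def starLift {X A : Type u} [CStarAlgebra A] (φ : X → A) : FreeAlgebra ℂ (X ⊕ X) →ₐ[ℂ] A :=
  FreeAlgebra.lift ℂ (Sum.elim φ (star ∘ φ))

variable {X A B : Type u} [CStarAlgebra A] [CStarAlgebra B]

@[simp]
theorem starLift_inl (φ : X → A) (x : X) : starLift φ (FreeAlgebra.ι ℂ (.inl x)) = φ x := by
  simp [starLift]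

@[simp]
theorem starLift_inr (φ : X → A) (x : X) :
    starLift φ (FreeAlgebra.ι ℂ (.inr x)) = star (φ x) := by
  simp [starLift]

theorem map_starLift (f : A →⋆ₐ[ℂ] B) (φ : X → A) (t : FreeAlgebra ℂ (X ⊕ X)) :
    f (starLift φ t) = starLift (f ∘ φ) t := by
  have : f.toAlgHom.comp (starLift φ) = starLift (f ∘ φ) := by
    ext x
    rcases x with x | x <;> simp [map_star]
  exact DFunLike.congr_fun this t

theorem coe_adjoin_eq_range_starLift (φ : X → A) :
    (StarAlgebra.adjoin ℂ (Set.range φ) : Set A) = Set.range (starLift φ) := by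
  have h := Algebra.adjoin_range_eq_range_freeAlgebra_lift ℂ (X ⊕ X)
    (Sum.elim φ (star ∘ φ))
  have h2 : Set.range φ ∪ star (Set.range φ) = Set.range (Sum.elim φ (star ∘ φ)) := by
    rw [Set.Sum.elim_range, Set.range_comp, Set.image_star]
  rw [← StarSubalgebra.coe_toSubalgebra, StarAlgebra.adjoin_toSubalgebra, h2, h]
  rfl

/-- A norm-decreasing assignment on the generators of a C*-algebra extends to a star-homomorphism.
-/
theorem exists_starAlgHom_of_norm_le (η : X → A) (hη : DenseRange (starLift η)) (ψ : X → B)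
    (h : ∀ t, ‖starLift ψ t‖ ≤ ‖starLift η t‖) : ∃ g : A →⋆ₐ[ℂ] B, g ∘ η = ψ := by
  let e : FreeAlgebra ℂ (X ⊕ X) →ₗ[ℂ] A := (starLift η).toLinearMap
  let f : FreeAlgebra ℂ (X ⊕ X) →ₗ[ℂ] B := (starLift ψ).toLinearMap
  let g : A →L[ℂ] B := f.extendOfNorm e
  -- The norm bound makes the assignment well defined on the dense image of the polynomials, and it
  -- extends by continuity.
  have hg (t) : g (starLift η t) = starLift ψ t :=
    LinearMap.extendOfNorm_eq (f := f) (e := e) hη ⟨1, fun x => by rw [one_mul]; exact h x⟩ t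
  have hmul (x y : A) : g (x * y) = g x * g y := by
    refine hη.induction_on₂ (p := fun x y => g (x * y) = g x * g y) ?_ ?_ x y
    · exact isClosed_eq (by fun_prop) (by fun_prop)
    · intro s t
      rw [← map_mul, hg, hg, hg, map_mul]
  have hone : g 1 = 1 := by simpa using hg 1
  have hstar (x : A) : g (star x) = star (g x) := by
    refine hη.induction_on (p := fun x => g (star x) = star (g x)) x ?_ ?_
    · exact isClosed_eq (by fun_prop) (by fun_prop)
    · intro t
      induction t using FreeAlgebra.induction with
      | grade0 c =>
        simp only [Algebra.algebraMap_eq_smul_one, star_smul, map_one, star_one, map_smul, hone]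
      | grade1 x =>
        have h1 (x : X) : g (η x) = ψ x := by simpa using hg (FreeAlgebra.ι ℂ (.inl x))
        have h2 (x : X) : g (star (η x)) = star (ψ x) := by
          simpa using hg (FreeAlgebra.ι ℂ (.inr x))
        rcases x with x | x <;> simp [h1, h2]
      | mul a b ha hb => rw [map_mul, star_mul, hmul, hmul, star_mul, ha, hb]
      | add a b ha hb => rw [map_add, star_add, map_add, map_add, star_add, ha, hb]
  refine ⟨{ toFun := g, map_one' := hone, map_mul' := hmul, map_zero' := map_zero g,
            map_add' := map_add g, map_star' := hstar,
            commutes' := fun c => ?_ }, ?_⟩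
  · rw [Algebra.algebraMap_eq_smul_one, map_smul, hone, Algebra.algebraMap_eq_smul_one]
  · ext x
    simpa using hg (FreeAlgebra.ι ℂ (.inl x))

theorem starAlgHom_ext_of_denseRange (η : X → A) (hη : DenseRange (starLift η))
    {g₁ g₂ : A →⋆ₐ[ℂ] B} (h : g₁ ∘ η = g₂ ∘ η) : g₁ = g₂ := by
  have hc (g : A →⋆ₐ[ℂ] B) : Continuous g :=
    AddMonoidHomClass.continuous_of_bound g 1 fun x => by
      rw [one_mul]
      exact NonUnitalStarAlgHom.norm_apply_le g x
  refine DFunLike.coe_injective (hη.equalizer (hc g₁) (hc g₂) ?_)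
  funext t
  simp only [Function.comp_apply, map_starLift, h]

end

end CStarAlgebra

namespace CStarAlgCat

open CStarAlgebra
open scoped ENNReal

/-- A family of homomorphisms that determines the norm. -/
def IsNorming {J : Type u} {A : J → CStarAlgCat.{u}} {B : CStarAlgCat.{u}}
    (p : ∀ j, B ⟶ A j) : Prop :=
  ∀ (x : B) (c : ℝ), 0 ≤ c → (∀ j, ‖(p j).hom x‖ ≤ c) → ‖x‖ ≤ c

theorem IsNorming.ext {J : Type u} {A : J → CStarAlgCat.{u}} {B : CStarAlgCat.{u}}
    {p : ∀ j, B ⟶ A j} (hp : IsNorming p) {x y : B} (h : ∀ j, (p j).hom x = (p j).hom y) :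
    x = y := by
  rw [← sub_eq_zero, ← norm_le_zero_iff]
  exact hp _ 0 le_rfl fun j => by rw [map_sub, h, sub_self, norm_zero]

/-- A bounded class of maps from a set to C*-algebras that can be tested on norming families is
represented by a C*-algebra. -/
theorem exists_universal {X : Type u} (b : X → ℝ) (P : ∀ A : CStarAlgCat.{u}, (X → A) → Prop)
    (hb : ∀ A φ, P A φ → ∀ x, ‖φ x‖ ≤ b x)
    (hP : ∀ {J : Type u} {A : J → CStarAlgCat.{u}} {B : CStarAlgCat.{u}} (p : ∀ j, B ⟶ A j),
      IsNorming p → ∀ φ : X → B, (∀ j, P (A j) ((p j).hom ∘ φ)) → P B φ) :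
    ∃ (F : CStarAlgCat.{u}) (η : X → F), P F η ∧
      ∀ (B : CStarAlgCat.{u}) (ψ : X → B), P B ψ → ∃! g : F ⟶ B, g.hom ∘ η = ψ := by
  -- Indexing by a polynomial and an attained norm, rather than by all test maps, keeps `J` in `Type
  -- u`. Zero targets are excluded so that the bounded product has a unit of norm one.
  let J : Type u := {q : FreeAlgebra ℂ (X ⊕ X) × ℝ //
    ∃ (A : CStarAlgCat.{u}) (φ : X → A), Nontrivial A ∧ P A φ ∧ ‖starLift φ q.1‖ = q.2}
  choose A φ hA hPφ hφ using fun j : J => j.2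
  let _ : CStarAlgebra (lp (fun j => A j) ∞) := lpInfty _
  let η₀ (x : X) : lp (fun j => A j) ∞ :=
    ⟨fun j => φ j x, memℓp_infty ⟨b x, by rintro _ ⟨j, rfl⟩; exact hb _ _ (hPφ j) x⟩⟩
  let S := (StarAlgebra.adjoin ℂ (Set.range η₀)).topologicalClosure
  have hS : IsClosed (S : Set (lp (fun j => A j) ∞)) :=
    StarSubalgebra.isClosed_topologicalClosure _
  let F : CStarAlgCat.{u} := ⟨S⟩
  let η (x : X) : F := ⟨η₀ x, StarSubalgebra.le_topologicalClosure _
    (StarAlgebra.subset_adjoin ℂ _ ⟨x, rfl⟩)⟩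
  have hval (t) : ((starLift η t : S) : lp (fun j => A j) ∞) = starLift η₀ t :=
    map_starLift S.subtype η t
  have hη : DenseRange (starLift η) := by
    intro x
    have hx : (x : lp (fun j => A j) ∞) ∈ closure (Set.range (starLift η₀)) := by
      rw [← coe_adjoin_eq_range_starLift]
      exact x.2
    refine closure_subtype.2 (closure_mono ?_ hx)
    rintro _ ⟨t, rfl⟩
    exact ⟨_, ⟨t, rfl⟩, hval t⟩
  let p (j : J) : F ⟶ A j := ⟨(lpEval (fun j => A j) j).comp S.subtype⟩
  have hp : IsNorming p := fun x c hc h => lp.norm_le_of_forall_le hc h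
  refine ⟨F, η, hP p hp η hPφ, fun B ψ hψ => ?_⟩
  have hle (t) : ‖starLift ψ t‖ ≤ ‖starLift η t‖ := by
    rcases subsingleton_or_nontrivial B with hB | hB
    · rw [Subsingleton.elim (starLift ψ t) 0, norm_zero]
      exact norm_nonneg _
    -- The chosen `φ j` need not be `ψ`, but it gives `t` the same norm; the index varies with `t`.
    · let j : J := ⟨(t, ‖starLift ψ t‖), B, ψ, hB, hψ, rfl⟩
      have h1 : ‖starLift (φ j) t‖ = ‖starLift ψ t‖ := hφ j
      have h2 : (p j).hom (starLift η t) = starLift (φ j) t := map_starLift (p j).hom η t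
      rw [← h1, ← h2]
      exact NonUnitalStarAlgHom.norm_apply_le (p j).hom _
  obtain ⟨g, hg⟩ := exists_starAlgHom_of_norm_le η hη ψ hle
  refine ⟨⟨g⟩, hg, fun g' hg' => ?_⟩
  exact Hom.ext (starAlgHom_ext_of_denseRange η hη (hg'.trans hg.symm))

end CStarAlgCat

/-! Monadicity criteria -/

namespace CategoryTheory.Functor

open Limits

universe v₁ v₂ v₃ u₁ u₂ u₃

variable {C : Type u₁} [Category.{v₁} C] {D : Type u₂} [Category.{v₂} D]
  {E : Type u₃} [Category.{v₃} E]

/-- A functor with universal arrows from all objects has a left adjoint. -/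
theorem isRightAdjoint_of_universal (G : C ⥤ D)
    (h : ∀ X : D, ∃ (F : C) (η : X ⟶ G.obj F), ∀ (B : C) (ψ : X ⟶ G.obj B),
      ∃! g : F ⟶ B, η ≫ G.map g = ψ) : G.IsRightAdjoint := by
  have (X : D) : HasInitial (StructuredArrow X G) := by
    obtain ⟨F, η, hη⟩ := h X
    choose g hg hu using hη
    refine IsInitial.hasInitial (X := StructuredArrow.mk η)
      (IsInitial.ofUniqueHom (fun Y => StructuredArrow.homMk (g Y.right Y.hom) (hg _ _)) ?_)
    intro Y m
    ext
    exact hu _ _ _ (StructuredArrow.w m)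
  exact isRightAdjointOfStructuredArrowInitials G

/-- The domain has coequalizers of the pairs that become split, and the functor preserves them. -/
def PreservesSplitCoequalizers (G : C ⥤ D) : Prop :=
  ∀ ⦃A B : C⦄ (f g : A ⟶ B) [G.IsSplitPair f g],
    HasCoequalizer f g ∧ PreservesColimit (parallelPair f g) G

theorem hasCoequalizer_and_preservesColimit (G : C ⥤ D) {A B Q : C} {f g : A ⟶ B} (q : B ⟶ Q)
    [Epi q] [Epi (G.map q)] (hq : f ≫ q = g ≫ q)
    (h₁ : ∀ (X : C) (k : B ⟶ X), f ≫ k = g ≫ k → ∃ l : Q ⟶ X, q ≫ l = k)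
    (h₂ : ∀ (X : D) (k : G.obj B ⟶ X), G.map f ≫ k = G.map g ≫ k →
      ∃ l : G.obj Q ⟶ X, G.map q ≫ l = k) :
    HasCoequalizer f g ∧ PreservesColimit (parallelPair f g) G := by
  have t : IsColimit (Cofork.ofπ q hq) := Cofork.IsColimit.mk _
    (fun s => (h₁ _ s.π s.condition).choose) (fun s => (h₁ _ s.π s.condition).choose_spec)
    (fun s m hm => (cancel_epi q).1 (hm.trans (h₁ _ s.π s.condition).choose_spec.symm))
  refine ⟨⟨⟨_, t⟩⟩, preservesColimit_of_preserves_colimit_cocone t ?_⟩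
  refine (isColimitMapCoconeCoforkEquiv G hq).symm ?_
  exact Cofork.IsColimit.mk _
    (fun s => (h₂ _ s.π s.condition).choose) (fun s => (h₂ _ s.π s.condition).choose_spec)
    (fun s m hm => (cancel_epi (G.map q)).1 (hm.trans (h₂ _ s.π s.condition).choose_spec.symm))

/-- The split coequalizer in `D` is absolute, so `H` preserves it; reflecting isomorphisms, `H` then
also reflects it, and preservation by `G ⋙ H` gives preservation by `G`. -/
theorem PreservesSplitCoequalizers.of_comp {G : C ⥤ D} {H : D ⥤ E} [H.ReflectsIsomorphisms]
    (h : (G ⋙ H).PreservesSplitCoequalizers) : G.PreservesSplitCoequalizers := by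
  intro A B f g _
  have : (G ⋙ H).IsSplitPair f g := map_is_split_pair H (G.map f) (G.map g)
  obtain ⟨h₁, h₂⟩ := h f g
  refine ⟨h₁, ?_⟩
  have : HasColimit (parallelPair f g ⋙ G) := by
    rw [hasColimit_iff_of_iso (diagramIsoParallelPair _)]
    exact inferInstanceAs (HasCoequalizer (G.map f) (G.map g))
  have : PreservesColimit (parallelPair f g ⋙ G) H :=
    @preservesColimit_of_iso_diagram _ _ _ _ _ _ _ _ H
      (diagramIsoParallelPair (parallelPair f g ⋙ G)).symm
      (inferInstanceAs (PreservesColimit (parallelPair (G.map f) (G.map g)) H))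
  have := reflectsColimit_of_reflectsIsomorphisms (parallelPair f g ⋙ G) H
  exact preservesColimit_of_reflects_of_preserves G H

end CategoryTheory.Functor

namespace CategoryTheory

universe v u₁ u₂

theorem nonempty_monadicRightAdjoint {C : Type u₁} [Category.{v} C] {D : Type u₂}
    [Category.{v} D] (G : C ⥤ D) [hG : G.IsRightAdjoint] [G.ReflectsIsomorphisms]
    (h : G.PreservesSplitCoequalizers) : Nonempty (MonadicRightAdjoint G) := by
  have : Monad.HasCoequalizerOfIsSplitPair G := ⟨fun f g _ => (h f g).1⟩
  have : Monad.PreservesColimitOfIsSplitPair G := ⟨fun f g _ => (h f g).2⟩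
  exact ⟨Monad.monadicOfHasPreservesGSplitCoequalizersOfReflectsIsomorphisms
    (Adjunction.ofIsRightAdjoint G)⟩

end CategoryTheory

/-! Isomorphisms -/

namespace BanCat

theorem hom_apply_eq {V W : BanCat.{u}} {f g : V ⟶ W} (h : f = g) (x : V) :
    f.hom x = g.hom x := by rw [h]

theorem hom_ext_apply {V W : BanCat.{u}} {f g : V ⟶ W} (h : ∀ x, f.hom x = g.hom x) : f = g :=
  Hom.ext (LinearMap.ext h)

/-- A contraction with a contractive inverse map is an isometric bijection. -/
theorem exists_inverse {V W : BanCat.{u}} (f : V ⟶ W) [IsIso f] :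
    ∃ g : W → V, (∀ x, g (f.hom x) = x) ∧ (∀ y, f.hom (g y) = y) ∧ ∀ y, ‖g y‖ ≤ ‖y‖ :=
  ⟨(inv f).hom, hom_apply_eq (IsIso.hom_inv_id f), hom_apply_eq (IsIso.inv_hom_id f),
    (inv f).norm_le⟩

end BanCat

/-- The inverse of a bijective homomorphism is a homomorphism; its contractivity comes from the
inverse in Banach spaces. -/
instance BanAlgCat.reflectsIsomorphisms_toBan :
    BanAlgCat.toBan.{u}.ReflectsIsomorphisms where
  reflects {A B} f _ := by
    obtain ⟨g, hg₁, hg₂, hg₃⟩ := BanCat.exists_inverse (toBan.map f)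
    let e : A ≃ₐ[ℂ] B := AlgEquiv.ofBijective f.hom
      (Function.bijective_iff_has_inverse.2 ⟨g, hg₁, hg₂⟩)
    have he (y : B) : e.symm y = g y := e.injective ((e.apply_symm_apply y).trans (hg₂ y).symm)
    refine ⟨⟨e.symm.toAlgHom, fun y => (congrArg _ (he y)).trans_le (hg₃ y)⟩, ?_, ?_⟩
    · exact Hom.ext (AlgHom.ext fun x => e.symm_apply_apply x)
    · exact Hom.ext (AlgHom.ext fun x => e.apply_symm_apply x)

instance BanStarAlgCat.reflectsIsomorphisms_toBan :
    (BanStarAlgCat.toBanAlg.{u} ⋙ BanAlgCat.toBan).ReflectsIsomorphisms where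
  reflects {A B} f _ := by
    obtain ⟨g, hg₁, hg₂, hg₃⟩ := BanCat.exists_inverse ((toBanAlg ⋙ BanAlgCat.toBan).map f)
    let e : A ≃⋆ₐ[ℂ] B := StarAlgEquiv.ofBijective f.hom
      (Function.bijective_iff_has_inverse.2 ⟨g, hg₁, hg₂⟩)
    have he (y : B) : e.symm y = g y := e.injective ((e.apply_symm_apply y).trans (hg₂ y).symm)
    refine ⟨⟨(e.symm : B →⋆ₐ[ℂ] A), fun y => (congrArg _ (he y)).trans_le (hg₃ y)⟩, ?_, ?_⟩
    · exact Hom.ext (StarAlgHom.ext fun x => e.symm_apply_apply x)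
    · exact Hom.ext (StarAlgHom.ext fun x => e.apply_symm_apply x)

namespace CStarAlgCat

instance reflectsIsomorphisms_toBan : toBan.{u}.ReflectsIsomorphisms where
  reflects {A B} f _ := by
    obtain ⟨g, hg₁, hg₂, -⟩ := BanCat.exists_inverse (toBan.map f)
    let e : A ≃⋆ₐ[ℂ] B := StarAlgEquiv.ofBijective f.hom
      (Function.bijective_iff_has_inverse.2 ⟨g, hg₁, hg₂⟩)
    refine ⟨⟨(e.symm : B →⋆ₐ[ℂ] A)⟩, ?_, ?_⟩
    · exact Hom.ext (StarAlgHom.ext fun x => e.symm_apply_apply x)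
    · exact Hom.ext (StarAlgHom.ext fun x => e.apply_symm_apply x)

/-! Coequalizers of pairs that split in Banach spaces -/

theorem hom_apply_eq {A B : CStarAlgCat.{u}} {f g : A ⟶ B} (h : f = g) (x : A) :
    f.hom x = g.hom x := by rw [h]

theorem hom_ext_apply {A B : CStarAlgCat.{u}} {f g : A ⟶ B} (h : ∀ x, f.hom x = g.hom x) :
    f = g :=
  Hom.ext (StarAlgHom.ext h)

/-- A pair of star-homomorphisms that splits in Banach spaces has a surjective coequalizer that
is also a coequalizer of Banach spaces. -/
theorem exists_coequalizer {A B : CStarAlgCat.{u}} (f g : A ⟶ B) {Z : BanCat.{u}}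
    {h : toBan.obj B ⟶ Z} (s : IsSplitCoequalizer (toBan.map f) (toBan.map g) h) :
    ∃ (Q : CStarAlgCat.{u}) (q : B ⟶ Q), Function.Surjective q.hom ∧ f ≫ q = g ≫ q ∧
      (∀ (E : CStarAlgCat.{u}) (k : B ⟶ E), f ≫ k = g ≫ k → ∃ l : Q ⟶ E, q ≫ l = k) ∧
      ∀ (E : BanCat.{u}) (k : toBan.obj B ⟶ E), toBan.map f ≫ k = toBan.map g ≫ k →
        ∃ l : toBan.obj Q ⟶ E, toBan.map q ≫ l = k := by
  let t : B → A := s.leftSection.hom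
  let m : B →ₗ[ℂ] Z := h.hom
  have hgt (b : B) : g.hom (t b) = b := BanCat.hom_apply_eq s.leftSection_bottom b
  have hft (b : B) (hb : m b = 0) : f.hom (t b) = 0 := by
    refine (BanCat.hom_apply_eq s.leftSection_top b).trans ?_
    change s.rightSection.hom (m b) = 0
    rw [hb]
    exact map_zero s.rightSection.hom
  have hfg (a : A) : m (f.hom a) = m (g.hom a) := BanCat.hom_apply_eq s.condition a
  have hker (a : A) (ha : f.hom a = 0) : m (g.hom a) = 0 := by
    rw [← hfg, ha, map_zero]
  -- The kernel of `m`. For `m b = 0`, the product `c * b` is the image under `g` of `t c * t b`,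
  -- which `f` kills, although `t` is only linear.
  let I : Ideal B :=
    { carrier := {b | m b = 0}
      add_mem' := fun {a b} ha hb => by
        rw [Set.mem_ofPred_eq] at ha hb ⊢
        rw [map_add, ha, hb, add_zero]
      zero_mem' := map_zero m
      smul_mem' := fun c b hb => by
        have := hker (t c * t b) (by rw [map_mul, hft b hb, mul_zero])
        rwa [map_mul, hgt, hgt] at this }
  have hI (b : B) : b ∈ I ↔ m b = 0 := Iff.rfl
  have : I.IsTwoSided := ⟨fun {b} c hb => by
    have := hker (t b * t c) (by rw [map_mul, hft b hb, zero_mul])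
    rwa [map_mul, hgt, hgt] at this⟩
  have hcl : IsClosed (I : Set B) := by
    have hc : Continuous m := AddMonoidHomClass.continuous_of_bound m 1 fun x => by
      rw [one_mul]; exact h.norm_le x
    exact isClosed_singleton.preimage hc
  have hs (b : B) (hb : b ∈ I) : star b ∈ I := by
    have := hker (star (t b)) (by rw [map_star, hft b hb, star_zero])
    rwa [map_star, hgt] at this
  let cs : CStarAlgebra (B ⧸ I) := CStarAlgebra.quotient I hs
  let Q : CStarAlgCat.{u} := ⟨B ⧸ I⟩
  let q : B ⟶ Q := ⟨
    { toFun := Ideal.Quotient.mk I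
      map_one' := rfl
      map_mul' := fun _ _ => rfl
      map_zero' := rfl
      map_add' := fun _ _ => rfl
      commutes' := fun _ => rfl
      map_star' := fun _ => rfl }⟩
  have hq : Function.Surjective q.hom := Ideal.Quotient.mk_surjective
  refine ⟨Q, q, hq, ?_, ?_, ?_⟩
  · refine hom_ext_apply fun a => ?_
    refine (Ideal.Quotient.eq (I := I)).2 ?_
    rw [hI]
    exact (map_sub m _ _).trans (sub_eq_zero.2 (hfg a))
  · intro E k hk
    -- For `b ∈ I`, `k b = k (g (t b)) = k (f (t b)) = 0`.
    have hk0 (b : B) (hb : b ∈ I) : k.hom b = 0 := by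
      rw [← hgt b]
      refine (hom_apply_eq hk (t b)).symm.trans ?_
      change k.hom (f.hom (t b)) = 0
      rw [hft b hb, map_zero]
    let l₀ : B ⧸ I →ₐ[ℂ] E := Ideal.Quotient.liftₐ I k.hom.toAlgHom hk0
    refine ⟨⟨{ l₀ with map_star' := ?_ }⟩, hom_ext_apply fun b => rfl⟩
    intro x
    obtain ⟨b, rfl⟩ := hq x
    exact map_star k.hom b
  · intro E k hk
    have hk0 (b : B) (hb : b ∈ I) : k.hom b = 0 := by
      rw [← hgt b]
      refine (BanCat.hom_apply_eq hk (t b)).symm.trans ?_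
      change k.hom (f.hom (t b)) = 0
      rw [hft b hb]
      exact map_zero k.hom
    let l₀ : B ⧸ I →ₗ[ℂ] E := (I.restrictScalars ℂ).liftQ k.hom hk0
    refine ⟨⟨l₀, fun x => ?_⟩, BanCat.hom_ext_apply fun b => rfl⟩
    -- The bound `‖k b‖ ≤ ‖b‖` for every representative `b` makes the induced map contractive.
    refine (QuotientAddGroup.le_norm_iff (S := I.toAddSubgroup)).2 fun b hb => ?_
    subst hb
    exact k.norm_le b

theorem preservesSplitCoequalizers_toBan : toBan.{u}.PreservesSplitCoequalizers := by
  intro A B f g hfg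
  obtain ⟨Z, h, ⟨s⟩⟩ := hfg.splittable
  obtain ⟨Q, q, hq, hfq, h₁, h₂⟩ := exists_coequalizer f g s
  have : Epi q := ⟨fun a b hab => hom_ext_apply fun x => by
    obtain ⟨y, rfl⟩ := hq x
    exact hom_apply_eq hab y⟩
  have : Epi (toBan.map q) := ⟨fun a b hab => BanCat.hom_ext_apply fun x => by
    obtain ⟨y, rfl⟩ := hq x
    exact BanCat.hom_apply_eq hab y⟩
  exact toBan.hasCoequalizer_and_preservesColimit q hfq h₁ h₂

end CStarAlgCat

namespace CommCStarAlgCat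

open CStarAlgCat

theorem preservesSplitCoequalizers_toBan :
    CommCStarAlgCat.toBan.{u}.PreservesSplitCoequalizers := by
  intro A B f g hfg
  obtain ⟨Z, h, ⟨s⟩⟩ := hfg.splittable
  obtain ⟨Q, q, hq, hfq, h₁, h₂⟩ := exists_coequalizer f.hom g.hom s
  -- The coequalizer among all C*-algebras is a quotient of `B`, so it already lies in the
  -- commutative subcategory.
  have hQ : IsComm Q := fun x y => by
    obtain ⟨a, rfl⟩ := hq x
    obtain ⟨b, rfl⟩ := hq y
    rw [← map_mul, B.property a b, map_mul]
  let q' : B ⟶ ⟨Q, hQ⟩ := ObjectProperty.homMk q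
  have : Epi q' := ⟨fun a b hab => ObjectProperty.hom_ext _ (hom_ext_apply fun x => by
    obtain ⟨y, rfl⟩ := hq x
    exact hom_apply_eq (congrArg (fun m => m.hom) hab) y)⟩
  have : Epi (CommCStarAlgCat.toBan.map q') := ⟨fun a b hab => BanCat.hom_ext_apply fun x => by
    obtain ⟨y, rfl⟩ := hq x
    exact BanCat.hom_apply_eq hab y⟩
  refine CommCStarAlgCat.toBan.hasCoequalizer_and_preservesColimit q'
    (ObjectProperty.hom_ext _ hfq) (fun X k hk => ?_) h₂
  obtain ⟨l, hl⟩ := h₁ X.obj k.hom (congrArg (fun m => m.hom) hk)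
  exact ⟨ObjectProperty.homMk l, ObjectProperty.hom_ext _ hl⟩

end CommCStarAlgCat

/-! Universal arrows -/

namespace CStarAlgCat

universe v w

/-- A presentation of the morphisms from an object to C*-algebras as uniformly bounded maps on a
set, compatible with homomorphisms and detected by norming families. -/
structure ElementwiseHoms {D : Type w} [Category.{v} D] (W : CStarAlgCat.{u} ⥤ D) (X : D) where
  carrier : Type u
  toFun : ∀ {A : CStarAlgCat.{u}}, (X ⟶ W.obj A) → carrier → A
  injective : ∀ {A : CStarAlgCat.{u}}, Function.Injective (toFun (A := A))
  toFun_comp : ∀ {A B : CStarAlgCat.{u}} (k : X ⟶ W.obj A) (g : A ⟶ B),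
    toFun (k ≫ W.map g) = g.hom ∘ toFun k
  bound : carrier → ℝ
  norm_le : ∀ {A : CStarAlgCat.{u}} (k : X ⟶ W.obj A) (x : carrier), ‖toFun k x‖ ≤ bound x
  exists_lift : ∀ {J : Type u} {A : J → CStarAlgCat.{u}} {B : CStarAlgCat.{u}}
    (p : ∀ j, B ⟶ A j), IsNorming p → ∀ (φ : carrier → B) (k : ∀ j, X ⟶ W.obj (A j)),
    (∀ j x, toFun (k j) x = (p j).hom (φ x)) → ∃ k' : X ⟶ W.obj B, toFun k' = φ

theorem ElementwiseHoms.exists_universal {D : Type w} [Category.{v} D] {W : CStarAlgCat.{u} ⥤ D}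
    {X : D} (H : ElementwiseHoms W X) (Q : ObjectProperty CStarAlgCat.{u})
    (hQ : ∀ {J : Type u} {A : J → CStarAlgCat.{u}} {B : CStarAlgCat.{u}} (p : ∀ j, B ⟶ A j),
      IsNorming p → (∀ j, Q (A j)) → Q B) :
    ∃ (F : CStarAlgCat.{u}) (η : X ⟶ W.obj F), Q F ∧
      ∀ (B : CStarAlgCat.{u}) (ψ : X ⟶ W.obj B), Q B → ∃! g : F ⟶ B, η ≫ W.map g = ψ := by
  obtain ⟨F, _, ⟨hF, η, rfl⟩, hu⟩ := CStarAlgCat.exists_universal H.bound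
    -- Restricting the test algebras to `Q` puts the universal algebra itself in `Q`, by `hQ`.
    (fun A φ => Q A ∧ ∃ k : X ⟶ W.obj A, H.toFun k = φ)
    (by rintro A _ ⟨-, k, rfl⟩; exact H.norm_le k)
    (by
      intro J A B p hp φ h
      choose hA k hk using h
      exact ⟨hQ p hp hA, H.exists_lift p hp φ k fun j x => congrFun (hk j) x⟩)
  refine ⟨F, η, hF, fun B ψ hB => ?_⟩
  have h (g : F ⟶ B) : η ≫ W.map g = ψ ↔ g.hom ∘ H.toFun η = H.toFun ψ := by
    rw [← H.toFun_comp, H.injective.eq_iff]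
  simpa only [h] using hu B _ ⟨hB, ψ, rfl⟩

theorem ElementwiseHoms.isRightAdjoint {D : Type w} [Category.{v} D] {W : CStarAlgCat.{u} ⥤ D}
    (H : ∀ X, ElementwiseHoms W X) : W.IsRightAdjoint := by
  refine W.isRightAdjoint_of_universal fun X => ?_
  obtain ⟨F, η, -, h⟩ := (H X).exists_universal (fun _ => True) fun _ _ _ => trivial
  exact ⟨F, η, fun B ψ => h B ψ trivial⟩

theorem IsComm.of_isNorming {J : Type u} {A : J → CStarAlgCat.{u}} {B : CStarAlgCat.{u}}
    (p : ∀ j, B ⟶ A j) (hp : IsNorming p) (h : ∀ j, IsComm (A j)) : IsComm B := fun x y =>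
  hp.ext fun j => by rw [map_mul, h, map_mul]

/-- Norming families detect contractive linear maps. -/
noncomputable def linearMapOfIsNorming {J : Type u} {A : J → CStarAlgCat.{u}} {B : CStarAlgCat.{u}}
    {p : ∀ j, B ⟶ A j} (hp : IsNorming p) {V : Type u} [AddCommGroup V] [Module ℂ V]
    (φ : V → B) (k : ∀ j, V →ₗ[ℂ] A j) (hk : ∀ j x, k j x = (p j).hom (φ x)) : V →ₗ[ℂ] B where
  toFun := φ
  map_add' x y := hp.ext fun j => by rw [map_add, ← hk, ← hk, ← hk, map_add]
  map_smul' c x := hp.ext fun j => by rw [RingHom.id_apply, map_smul, ← hk, ← hk, map_smul]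

/-- Norming families detect algebra homomorphisms. -/
noncomputable def algHomOfIsNorming {J : Type u} {A : J → CStarAlgCat.{u}} {B : CStarAlgCat.{u}}
    {p : ∀ j, B ⟶ A j} (hp : IsNorming p) {V : Type u} [Ring V] [Algebra ℂ V]
    (φ : V → B) (k : ∀ j, V →ₐ[ℂ] A j) (hk : ∀ j x, k j x = (p j).hom (φ x)) : V →ₐ[ℂ] B :=
  AlgHom.ofLinearMap (linearMapOfIsNorming hp φ (fun j => (k j).toLinearMap) hk)
    (hp.ext fun j => (hk j 1).symm.trans ((map_one (k j)).trans (map_one (p j).hom).symm))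
    (fun x y => hp.ext fun j => by
      change (p j).hom (φ (x * y)) = (p j).hom (φ x * φ y)
      rw [map_mul, ← hk, ← hk, ← hk, map_mul])

/-- Norming families detect star-homomorphisms. -/
noncomputable def starAlgHomOfIsNorming {J : Type u} {A : J → CStarAlgCat.{u}}
    {B : CStarAlgCat.{u}} {p : ∀ j, B ⟶ A j} (hp : IsNorming p) {V : Type u} [Ring V] [Algebra ℂ V]
    [StarRing V] (φ : V → B) (k : ∀ j, V →⋆ₐ[ℂ] A j) (hk : ∀ j x, k j x = (p j).hom (φ x)) :
    V →⋆ₐ[ℂ] B :=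
  { algHomOfIsNorming hp φ (fun j => (k j).toAlgHom) hk with
    map_star' := fun x => hp.ext fun j => by
      change (p j).hom (φ (star x)) = (p j).hom (star (φ x))
      rw [map_star, ← hk, ← hk, map_star] }

theorem IsNorming.norm_le_of_eq {J : Type u} {A : J → CStarAlgCat.{u}} {B : CStarAlgCat.{u}}
    {p : ∀ j, B ⟶ A j} (hp : IsNorming p) {V : Type u} [NormedAddCommGroup V] {φ : V → B}
    (k : ∀ j, V → A j) (hk : ∀ j x, k j x = (p j).hom (φ x)) (h : ∀ j x, ‖k j x‖ ≤ ‖x‖) (x : V) :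
    ‖φ x‖ ≤ ‖x‖ :=
  hp _ _ (norm_nonneg x) fun j => by rw [← hk]; exact h j x

noncomputable def elementwiseHomsToBan (X : BanCat.{u}) : ElementwiseHoms toBan.{u} X where
  carrier := X
  toFun k := k.hom
  injective h := BanCat.hom_ext_apply fun x => congrFun h x
  toFun_comp _ _ := rfl
  bound x := ‖x‖
  norm_le k := k.norm_le
  exists_lift _ hp φ k hk := ⟨⟨linearMapOfIsNorming hp φ (fun j => (k j).hom) hk,
    hp.norm_le_of_eq _ hk fun j => (k j).norm_le⟩, rfl⟩

noncomputable def elementwiseHomsToBanAlg (X : BanAlgCat.{u}) :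
    ElementwiseHoms toBanAlg.{u} X where
  carrier := X
  toFun k := k.hom
  injective h := BanAlgCat.Hom.ext (AlgHom.ext fun x => congrFun h x)
  toFun_comp _ _ := rfl
  bound x := ‖x‖
  norm_le k := k.norm_le
  exists_lift _ hp φ k hk := ⟨⟨algHomOfIsNorming hp φ (fun j => (k j).hom) hk,
    hp.norm_le_of_eq _ hk fun j => (k j).norm_le⟩, rfl⟩

noncomputable def elementwiseHomsToBanStarAlg (X : BanStarAlgCat.{u}) :
    ElementwiseHoms toBanStarAlg.{u} X where
  carrier := X
  toFun k := k.hom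
  injective h := BanStarAlgCat.Hom.ext (StarAlgHom.ext fun x => congrFun h x)
  toFun_comp _ _ := rfl
  bound x := ‖x‖
  norm_le k := k.norm_le
  exists_lift _ hp φ k hk := ⟨⟨starAlgHomOfIsNorming hp φ (fun j => (k j).hom) hk,
    hp.norm_le_of_eq _ hk fun j => (k j).norm_le⟩, rfl⟩

end CStarAlgCat

/-! ### Left adjoints in the commutative case -/

namespace CommCStarAlgCat

open CStarAlgCat

universe v w

theorem isRightAdjoint_ι_comp {D : Type w} [Category.{v} D] {W : CStarAlgCat.{u} ⥤ D}
    (H : ∀ X, ElementwiseHoms W X) : (CStarAlgCat.IsComm.ι ⋙ W).IsRightAdjoint := by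
  refine Functor.isRightAdjoint_of_universal _ fun X => ?_
  obtain ⟨F, η, hF, h⟩ := (H X).exists_universal CStarAlgCat.IsComm IsComm.of_isNorming
  refine ⟨⟨F, hF⟩, η, fun B ψ => ?_⟩
  obtain ⟨g, hg, hu⟩ := h B.obj ψ B.property
  exact ⟨ObjectProperty.homMk g, hg, fun g' hg' => ObjectProperty.hom_ext _ (hu _ hg')⟩

theorem isRightAdjoint_lift {D : Type w} [Category.{v} D] {W : CStarAlgCat.{u} ⥤ D}
    (H : ∀ X, ElementwiseHoms W X) (P : ObjectProperty D)
    (hP : ∀ A, P ((CStarAlgCat.IsComm.ι ⋙ W).obj A)) :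
    (P.lift (CStarAlgCat.IsComm.ι ⋙ W) hP).IsRightAdjoint := by
  refine Functor.isRightAdjoint_of_universal _ fun X => ?_
  obtain ⟨F, η, hF, h⟩ := (H X.obj).exists_universal CStarAlgCat.IsComm IsComm.of_isNorming
  refine ⟨⟨F, hF⟩, ObjectProperty.homMk η, fun B ψ => ?_⟩
  obtain ⟨g, hg, hu⟩ := h B.obj ψ.hom B.property
  exact ⟨ObjectProperty.homMk g, ObjectProperty.hom_ext _ hg, fun g' hg' =>
    ObjectProperty.hom_ext _ (hu _ (congrArg (fun m => m.hom) hg'))⟩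

end CommCStarAlgCat

/-! ### Monadicity of the six forgetful functors -/

namespace CategoryTheory

universe v u₁ u₂ u₃

/-- Monadicity descends along the first factor of a composite whose second factor reflects
isomorphisms. -/
theorem nonempty_monadicRightAdjoint_of_comp {C : Type u₁} [Category.{v} C] {D : Type u₂}
    [Category.{v} D] {E : Type u₃} [Category.{v} E] (G : C ⥤ D) (H : D ⥤ E)
    (hG : G.IsRightAdjoint) [H.ReflectsIsomorphisms] (hr : (G ⋙ H).ReflectsIsomorphisms)
    (h : (G ⋙ H).PreservesSplitCoequalizers) : Nonempty (MonadicRightAdjoint G) :=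
  have := reflectsIsomorphisms_of_comp G H
  nonempty_monadicRightAdjoint G h.of_comp

end CategoryTheory

theorem mainTheorem4 :
    (Nonempty (MonadicRightAdjoint CStarAlgCat.toBanStarAlg.{u}) ∧
      Nonempty (MonadicRightAdjoint CStarAlgCat.toBanAlg.{u}) ∧
      Nonempty (MonadicRightAdjoint CStarAlgCat.toBan.{u})) ∧
    (Nonempty (MonadicRightAdjoint CommCStarAlgCat.toCommBanStarAlg.{u}) ∧
      Nonempty (MonadicRightAdjoint CommCStarAlgCat.toCommBanAlg.{u}) ∧
      Nonempty (MonadicRightAdjoint CommCStarAlgCat.toBan.{u})) := by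
  have hr : CommCStarAlgCat.toBan.{u}.ReflectsIsomorphisms :=
    inferInstanceAs (CStarAlgCat.IsComm.ι ⋙ CStarAlgCat.toBan).ReflectsIsomorphisms
  have hs := CStarAlgCat.preservesSplitCoequalizers_toBan.{u}
  have hc := CommCStarAlgCat.preservesSplitCoequalizers_toBan.{u}
  refine ⟨⟨?_, ?_, ?_⟩, ?_, ?_, ?_⟩
  · exact nonempty_monadicRightAdjoint_of_comp _ (BanStarAlgCat.toBanAlg ⋙ BanAlgCat.toBan)
      (CStarAlgCat.ElementwiseHoms.isRightAdjoint CStarAlgCat.elementwiseHomsToBanStarAlg)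
      CStarAlgCat.reflectsIsomorphisms_toBan hs
  · exact nonempty_monadicRightAdjoint_of_comp _ BanAlgCat.toBan
      (CStarAlgCat.ElementwiseHoms.isRightAdjoint CStarAlgCat.elementwiseHomsToBanAlg)
      CStarAlgCat.reflectsIsomorphisms_toBan hs
  · exact nonempty_monadicRightAdjoint _
      (hG := CStarAlgCat.ElementwiseHoms.isRightAdjoint CStarAlgCat.elementwiseHomsToBan) hs
  · exact nonempty_monadicRightAdjoint_of_comp _
      (BanStarAlgCat.IsComm.ι ⋙ BanStarAlgCat.toBanAlg ⋙ BanAlgCat.toBan)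
      (CommCStarAlgCat.isRightAdjoint_lift CStarAlgCat.elementwiseHomsToBanStarAlg _ _) hr hc
  · exact nonempty_monadicRightAdjoint_of_comp _ (BanAlgCat.IsComm.ι ⋙ BanAlgCat.toBan)
      (CommCStarAlgCat.isRightAdjoint_lift CStarAlgCat.elementwiseHomsToBanAlg _ _) hr hc
  · exact nonempty_monadicRightAdjoint _
      (hG := CommCStarAlgCat.isRightAdjoint_ι_comp CStarAlgCat.elementwiseHomsToBan) hc
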